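/- Let $S_n$ be the symmetric group on $[n]=\{1,\dots,n\}$ with simple generators $s_i=(i,i+1)$, $1\le i<n$, and let $\ell(w)$ be the least number of factors in an expression of $w\in S_n$ as a product of simple generators. Let $\circ$ be the Demazure product on $S_n$, the unique associative operation such that, for every $w\in S_n$ and every simple generator $s$, $w\circ s=ws$ if $\ell(ws)>\ell(w)$ and $w\circ s=w$ otherwise, and $s\circ w=sw$ if $\ell(sw)>\ell(w)$ and $s\circ w=w$ otherwise. Explicitly, $u\circ w=(\cdots((u\circ s_{i_1})\circ s_{i_2})\cdots)\circ s_{i_k}$ for any expression $w=s_{i_1}s_{i_2}\cdots s_{i_k}$ with $k=\ell(w)$. For $x,y\in S_n$ with $x=x^{-1}$ and $y=y^{-1}$, let $\mathcal{A}(x,y)$ be the set of elements of minimal length in $\{w\in S_n : w^{-1}\circ x\circ w=y\}$. The atoms of $y$ are the elements of $\mathcal{A}(y)=\mathcal{A}(1,y)$. If $y\in S_{2n}$ is an involution without fixed points, its FPF atoms are the elements of $\mathcal{A}_{\mathtt{FPF}}(y)=\mathcal{A}(s_1s_3s_5\cdots s_{2n-1},\,y)$. A permutation $w\in S_n$ is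 321-avoiding if there are no $i<j<k$ in $[n]$ with $w(i)>w(j)>w(k)$. (a) For every $n\ge 0$ and every $x\in S_n$ with $x=x^{-1}$ (the identity is allowed), $|\mathcal{A}(x)|=1$ if and only if $x$ is 321-avoiding. (b) For every $n\ge 0$ and every $x\in S_{2n}$ with $x=x^{-1}$ and no fixed points, $|\mathcal{A}_{\mathtt{FPF}}(x)|=1$ if and only if $x$ is 321-avoiding. -/

import Mathlib

open Equiv

namespace InvolutionAtoms

variable {n : ℕ}

/-- The simple generators `s_i = (i, i+1)` of the symmetric group on `n` letters. -/
def simpleReflections (n : ℕ) : Set (Perm (Fin n)) :=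
  {s | ∃ i j : Fin n, (i : ℕ) + 1 = (j : ℕ) ∧ s = swap i j}

/-- `l` is a word in the simple generators whose product is `w`. -/
def IsWord (l : List (Perm (Fin n))) (w : Perm (Fin n)) : Prop :=
  (∀ s ∈ l, s ∈ simpleReflections n) ∧ l.prod = w

/-- The Coxeter length: the least number of factors in an expression of `w` as a product of
simple generators (such an expression always exists, see `exists_isWord`). -/
noncomputable def length (w : Perm (Fin n)) : ℕ :=
  sInf {k | ∃ l : List (Perm (Fin n)), IsWord l w ∧ l.length = k}

/-- A reduced word of `w`. -/
def IsReducedWord (l : List (Perm (Fin n))) (w : Perm (Fin n)) : Prop :=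
  IsWord l w ∧ l.length = length w

theorem exists_isWord (w : Perm (Fin n)) : ∃ l : List (Perm (Fin n)), IsWord l w := by
  cases n with
  | zero => exact ⟨[], by simp, Subsingleton.elim _ _⟩
  | succ m =>
    have h : w ∈ Submonoid.closure (Set.range fun i : Fin m ↦ swap i.castSucc i.succ) := by
      rw [Equiv.Perm.mclosure_swap_castSucc_succ]
      trivial
    obtain ⟨l, hl, hw⟩ := Submonoid.exists_list_of_mem_closure h
    refine ⟨l, fun s hs ↦ ?_, hw⟩
    obtain ⟨i, hi⟩ := hl s hs
    exact ⟨i.castSucc, i.succ, by simp, hi.symm⟩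

theorem exists_isReducedWord (w : Perm (Fin n)) :
    ∃ l : List (Perm (Fin n)), IsReducedWord l w := by
  obtain ⟨l, hl⟩ := exists_isWord w
  exact Nat.sInf_mem (s := {k | ∃ l : List (Perm (Fin n)), IsWord l w ∧ l.length = k})
    ⟨l.length, l, hl, rfl⟩

/-- The product `w ∘ s` of a permutation with a simple generator: `w s` if this is longer than
`w`, and `w` otherwise. -/
noncomputable def demazureSimple (w s : Perm (Fin n)) : Perm (Fin n) :=
  if length w < length (w * s) then w * s else w

/-- A reduced word of `w`. -/
noncomputable def reducedWord (w : Perm (Fin n)) : List (Perm (Fin n)) :=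
  Classical.choose (exists_isReducedWord w)

/-- The Demazure product `u ∘ w`, the associative operation extending `demazureSimple`:
`u ∘ w = (⋯((u ∘ s₁) ∘ s₂) ⋯) ∘ s_k` for a reduced expression `w = s₁ s₂ ⋯ s_k`
(the result does not depend on the reduced expression). -/
noncomputable def demazure (u w : Perm (Fin n)) : Perm (Fin n) :=
  (reducedWord w).foldl demazureSimple u

/-- Demazure conjugation `w⁻¹ ∘ x ∘ w`. -/
noncomputable def demazureConj (x w : Perm (Fin n)) : Perm (Fin n) :=
  demazure (demazure w⁻¹ x) w

/-- The Hecke atoms of `y` relative to `x`. -/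
def heckeAtoms (x y : Perm (Fin n)) : Set (Perm (Fin n)) :=
  {w | demazureConj x w = y}

/-- The atoms of `y` relative to `x`: the Hecke atoms of minimal length. -/
def relAtoms (x y : Perm (Fin n)) : Set (Perm (Fin n)) :=
  {w | w ∈ heckeAtoms x y ∧ ∀ v ∈ heckeAtoms x y, length w ≤ length v}

/-- The atoms of `y`. -/
def atoms (y : Perm (Fin n)) : Set (Perm (Fin n)) :=
  relAtoms 1 y

/-- The permutation `s₁ s₃ s₅ ⋯ s_{2n-1}` of `2n` letters (written with letters `0, …, 2n-1`). -/
def fpfBase (n : ℕ) : Perm (Fin (2 * n)) :=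
  ((List.finRange n).map fun i : Fin n ↦
    swap (⟨2 * (i : ℕ), by omega⟩ : Fin (2 * n)) ⟨2 * (i : ℕ) + 1, by omega⟩).prod

/-- The FPF atoms of `y`. -/
def fpfAtoms (y : Perm (Fin (2 * n))) : Set (Perm (Fin (2 * n))) :=
  relAtoms (fpfBase n) y

/-- `w` is 321-avoiding. -/
def Avoids321 (w : Perm (Fin n)) : Prop :=
  ¬ ∃ i j k : Fin n, i < j ∧ j < k ∧ w j < w i ∧ w k < w j

end InvolutionAtoms

open Equiv

namespace InvolutionAtoms

variable {n : ℕ}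

/-! Read a Hecke atom letter by letter: Demazure conjugation by one generator either fixes an
involution or moves it up one step in involution weak order. A rank grows by a constant at each
strict step, so the shortest Hecke atoms are exactly the products of labels of saturated chains from
`x` to `y` (`relAtoms_eq_setOf_conjChain`). The claim becomes: all chains to `y` have the same label
product iff `y` avoids 321.

If `y` avoids 321, two distinct descents are never adjacent, and the corresponding downward steps
commute along with their labels. A diamond argument by induction on rank gives uniqueness
(`ConjChain.unique`). If `y` contains 321, one cycle is nested in another. Downward steps preserve
some nesting until it is tight, where two different choices of final labels give different products
(`ConjChain.exists_ne_of_nesting`).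

Both parts run in parallel through the proposition `p`, "no fixed points allowed". When `p` holds, a
downward step that would delete a cycle `(i j)` is forbidden; all that is needed of `x` is that it
is the only admissible involution with no permitted descent. -/

/-- The number of inversions of a permutation. -/
def invCount (w : Perm (Fin n)) : ℕ :=
  (Finset.univ.filter fun p : Fin n × Fin n ↦ p.1 < p.2 ∧ w p.2 < w p.1).card

/-! ### Coxeter length as the number of inversions -/

theorem swap_lt_swap {i j a b : Fin n} (h : (i : ℕ) + 1 = j) (hab : a < b)
    (hne : ¬(a = i ∧ b = j)) : swap i j a < swap i j b := by
  simp only [swap_apply_def, Fin.ext_iff, Fin.lt_def] at *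
  split_ifs <;> omega

/-- Applying the swap to both entries maps the inversions of `w` bijectively onto those of the
product other than `(i, j)`, which is new. -/
theorem invCount_mul_swap {i j : Fin n} (h : (i : ℕ) + 1 = j) {w : Perm (Fin n)}
    (hw : w i < w j) : invCount (w * swap i j) = invCount w + 1 := by
  have hij : i < j := by rw [Fin.lt_def]; omega
  have key : (Finset.univ.filter fun p : Fin n × Fin n ↦
      p.1 < p.2 ∧ (w * swap i j) p.2 < (w * swap i j) p.1) =
      insert (i, j) ((Finset.univ.filter fun p : Fin n × Fin n ↦ p.1 < p.2 ∧ w p.2 < w p.1).map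
        (Equiv.prodCongr (swap i j) (swap i j)).toEmbedding) := by
    ext ⟨a, b⟩
    rw [Finset.mem_insert, Finset.mem_map, Finset.mem_filter]
    simp only [Finset.mem_filter, Finset.mem_univ, true_and,
      Equiv.coe_toEmbedding, Prod.exists, Equiv.prodCongr_apply, Prod.map_apply, Prod.mk.injEq,
      Perm.mul_apply]
    constructor
    · rintro ⟨hab, hw'⟩
      by_cases hne : a = i ∧ b = j
      · exact Or.inl hne
      · exact Or.inr ⟨swap i j a, swap i j b, ⟨swap_lt_swap h hab hne, hw'⟩, by simp, by simp⟩
    · rintro (⟨rfl, rfl⟩ | ⟨c, d, ⟨hcd, hw'⟩, rfl, rfl⟩)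
      · exact ⟨hij, by simpa using hw⟩
      · refine ⟨swap_lt_swap h hcd ?_, by simpa using hw'⟩
        rintro ⟨rfl, rfl⟩
        exact absurd hw' hw.asymm
  rw [invCount, key, Finset.card_insert_of_notMem, Finset.card_map, invCount]
  simp only [Finset.mem_map, Finset.mem_filter, Finset.mem_univ, true_and, Equiv.coe_toEmbedding,
    Prod.exists, Equiv.prodCongr_apply, Prod.map_apply, Prod.mk.injEq, not_exists, not_and]
  intro c d hcd h1 h2
  rw [← Equiv.eq_symm_apply] at h1 h2
  simp only [symm_swap, swap_apply_left, swap_apply_right] at h1 h2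
  exact absurd hcd.1 (by rw [h1, h2]; exact hij.asymm)

theorem invCount_eq_mul_swap_add_one {i j : Fin n} (h : (i : ℕ) + 1 = j) {w : Perm (Fin n)}
    (hw : w j < w i) : invCount w = invCount (w * swap i j) + 1 := by
  have := invCount_mul_swap h (w := w * swap i j) (by simpa using hw)
  simpa [mul_assoc] using this

theorem invCount_mul_swap_le {i j : Fin n} (h : (i : ℕ) + 1 = j) (w : Perm (Fin n)) :
    invCount (w * swap i j) ≤ invCount w + 1 := by
  have hij : i ≠ j := by rintro rfl; omega
  rcases lt_or_gt_of_ne (w.injective.ne hij) with hw | hw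
  · exact (invCount_mul_swap h hw).le
  · have := invCount_eq_mul_swap_add_one h hw
    omega

theorem invCount_one : invCount (1 : Perm (Fin n)) = 0 := by
  rw [invCount, Finset.card_eq_zero, Finset.filter_eq_empty_iff]
  rintro ⟨a, b⟩ - ⟨h1, h2⟩
  exact h1.asymm h2

theorem eq_one_or_exists_descent (w : Perm (Fin n)) :
    w = 1 ∨ ∃ i j : Fin n, (i : ℕ) + 1 = j ∧ w j < w i := by
  refine or_iff_not_imp_right.2 fun hd ↦ ?_
  cases n with
  | zero => exact Subsingleton.elim _ _
  | succ m =>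
    have hmono : StrictMono w := Fin.strictMono_iff_lt_succ.2 fun i ↦ by
      have h1 : ¬ w i.succ < w i.castSucc := fun h ↦ hd ⟨i.castSucc, i.succ, by simp, h⟩
      exact lt_of_le_of_ne (not_lt.1 h1) (w.injective.ne (Fin.castSucc_lt_succ).ne)
    -- The identity is the only order automorphism of a finite chain.
    have := Subsingleton.elim (StrictMono.orderIsoOfSurjective w hmono w.surjective)
      (OrderIso.refl _)
    ext a
    exact congrArg (fun f : Fin (m + 1) ≃o Fin (m + 1) ↦ (f a : ℕ)) this

theorem invCount_prod_le (l : List (Perm (Fin n))) (hl : ∀ s ∈ l, s ∈ simpleReflections n) :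
    invCount l.prod ≤ l.length := by
  induction l using List.reverseRecOn with
  | nil => simp [invCount_one]
  | append_singleton l s ih =>
    obtain ⟨i, j, h, rfl⟩ := hl s (by simp)
    have h1 := ih fun t ht ↦ hl t (by simp [ht])
    have h2 := invCount_mul_swap_le h l.prod
    simp only [List.prod_append, List.prod_singleton, List.length_append, List.length_singleton]
    omega

theorem exists_isWord_length_eq_invCount (w : Perm (Fin n)) :
    ∃ l : List (Perm (Fin n)), IsWord l w ∧ l.length = invCount w := by
  induction hk : invCount w using Nat.strong_induction_on generalizing w with
  | _ k ih =>
    rcases eq_one_or_exists_descent w with rfl | ⟨i, j, h, hw⟩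
    · exact ⟨[], ⟨by simp, rfl⟩, by simpa [invCount_one] using hk⟩
    · have h1 := invCount_eq_mul_swap_add_one h hw
      obtain ⟨l, ⟨hl, hp⟩, hlen⟩ := ih _ (by omega) (w * swap i j) rfl
      refine ⟨l ++ [swap i j], ⟨?_, by simp [hp, mul_assoc]⟩, by simp; omega⟩
      intro s hs
      rcases List.mem_append.1 hs with hs | hs
      · exact hl s hs
      · exact ⟨i, j, h, by simpa using hs⟩

theorem length_eq_invCount (w : Perm (Fin n)) : length w = invCount w := by
  refine le_antisymm (Nat.sInf_le (exists_isWord_length_eq_invCount w)) ?_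
  obtain ⟨l, ⟨hl, hp⟩, hlen⟩ := exists_isReducedWord w
  rw [← hlen, ← hp]
  exact invCount_prod_le l hl

theorem length_prod_le {l : List (Perm (Fin n))} (hl : ∀ s ∈ l, s ∈ simpleReflections n) :
    length l.prod ≤ l.length :=
  length_eq_invCount l.prod ▸ invCount_prod_le l hl

theorem inv_of_mem_simpleReflections {s : Perm (Fin n)} (hs : s ∈ simpleReflections n) :
    s⁻¹ = s := by
  obtain ⟨i, j, -, rfl⟩ := hs
  exact swap_inv i j

theorem IsWord.reverse {l : List (Perm (Fin n))} {w : Perm (Fin n)} (h : IsWord l w) :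
    IsWord l.reverse w⁻¹ := by
  refine ⟨fun s hs ↦ h.1 s (List.mem_reverse.1 hs), ?_⟩
  rw [← h.2, List.prod_inv_reverse]
  congr 2
  conv_lhs => rw [← List.map_id l]
  exact List.map_congr_left fun s hs ↦ (inv_of_mem_simpleReflections (h.1 s hs)).symm

theorem length_inv (w : Perm (Fin n)) : length w⁻¹ = length w := by
  have key : ∀ w : Perm (Fin n), length w⁻¹ ≤ length w := fun w ↦ by
    obtain ⟨l, h, hlen⟩ := exists_isReducedWord w
    rw [← hlen, ← List.length_reverse]
    exact Nat.sInf_le ⟨_, h.reverse, rfl⟩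
  exact le_antisymm (key w) (by simpa using key w⁻¹)

theorem IsReducedWord.reverse {l : List (Perm (Fin n))} {w : Perm (Fin n)}
    (h : IsReducedWord l w) : IsReducedWord l.reverse w⁻¹ :=
  ⟨h.1.reverse, by rw [List.length_reverse, h.2, length_inv]⟩

/-! ### The Demazure product as commuting left and right actions -/

theorem demazureSimple_swap {i j : Fin n} (h : (i : ℕ) + 1 = j) (w : Perm (Fin n)) :
    demazureSimple w (swap i j) = if w i < w j then w * swap i j else w := by
  have hij : i ≠ j := by rintro rfl; omega
  rw [demazureSimple, length_eq_invCount, length_eq_invCount]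
  rcases lt_or_gt_of_ne (w.injective.ne hij) with hw | hw
  · have := invCount_mul_swap h hw
    rw [if_pos (by omega), if_pos hw]
  · have := invCount_eq_mul_swap_add_one h hw
    rw [if_neg (by omega), if_neg hw.asymm]

/-- The product `s ∘ w` of a simple generator with a permutation. -/
noncomputable def demazureLeft (w s : Perm (Fin n)) : Perm (Fin n) :=
  (demazureSimple w⁻¹ s)⁻¹

theorem demazureLeft_swap {i j : Fin n} (h : (i : ℕ) + 1 = j) (w : Perm (Fin n)) :
    demazureLeft w (swap i j) = if w⁻¹ i < w⁻¹ j then swap i j * w else w := by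
  rw [demazureLeft, demazureSimple_swap h]
  split_ifs <;> simp

/-- Multiplying on one side does not affect the length comparison on the other, unless `w` maps the
pair `{k, l}` onto `{i, j}`. If it does so in order, `w * t = s * w` and both sides equal this; if
in reverse order, neither action moves `w`. -/
theorem demazureLeft_demazureSimple {s t : Perm (Fin n)} (hs : s ∈ simpleReflections n)
    (ht : t ∈ simpleReflections n) (w : Perm (Fin n)) :
    demazureLeft (demazureSimple w t) s = demazureSimple (demazureLeft w s) t := by
  obtain ⟨i, j, h, rfl⟩ := hs
  obtain ⟨k, l, h', rfl⟩ := ht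
  have hij : i < j := by rw [Fin.lt_def]; omega
  have hkl : k < l := by rw [Fin.lt_def]; omega
  by_cases hex : w⁻¹ i = k ∧ w⁻¹ j = l
  · obtain ⟨hk, hl⟩ := hex
    have hwk : w k = i := by rw [← hk]; simp
    have hwl : w l = j := by rw [← hl]; simp
    have hc : w * swap k l = swap i j * w := by
      rw [← hwk, ← hwl, Equiv.mul_swap_eq_swap_mul]
    rw [demazureSimple_swap h', demazureLeft_swap h w, hwk, hwl, hk, hl, if_pos hij, if_pos hkl,
      ← hc, demazureSimple_swap h', demazureLeft_swap h]
    have hk' : w.symm i = k := hk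
    have hl' : w.symm j = l := hl
    simp [hk', hl', hwk, hwl, hij.asymm, hkl.asymm]
  by_cases hex' : w⁻¹ i = l ∧ w⁻¹ j = k
  · obtain ⟨hl, hk⟩ := hex'
    have hwk : w k = j := by rw [← hk]; simp
    have hwl : w l = i := by rw [← hl]; simp
    rw [demazureSimple_swap h', demazureLeft_swap h w, hwk, hwl, hk, hl, if_neg hij.asymm,
      if_neg hkl.asymm, demazureSimple_swap h', demazureLeft_swap h, hwk, hwl, hk, hl,
      if_neg hij.asymm, if_neg hkl.asymm]
  have h1 : (w * swap k l)⁻¹ i < (w * swap k l)⁻¹ j ↔ w⁻¹ i < w⁻¹ j := by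
    simp only [mul_inv_rev, swap_inv, Perm.mul_apply]
    constructor
    · intro hlt
      rcases lt_or_gt_of_ne (w⁻¹.injective.ne hij.ne) with h2 | h2
      · exact h2
      · exact absurd hlt (swap_lt_swap h' h2 fun h3 ↦ hex' ⟨h3.2, h3.1⟩).asymm
    · exact fun h2 ↦ swap_lt_swap h' h2 hex
  have h2 : (swap i j * w) k < (swap i j * w) l ↔ w k < w l := by
    simp only [Perm.mul_apply]
    constructor
    · intro hlt
      rcases lt_or_gt_of_ne (w.injective.ne hkl.ne) with h2 | h2
      · exact h2
      · refine absurd hlt (swap_lt_swap h h2 fun h3 ↦ hex' ?_).asymm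
        rw [← h3.1, ← h3.2]; simp
    · refine fun h2 ↦ swap_lt_swap h h2 fun h3 ↦ hex ?_
      rw [← h3.1, ← h3.2]; simp
  rw [demazureSimple_swap h', demazureLeft_swap h w]
  split_ifs with h3 h4 h4 <;> rw [demazureSimple_swap h', demazureLeft_swap h] <;>
    simp only [h1, h2, h3, h4, if_true, if_false, mul_assoc]

theorem demazureLeft_foldl {s : Perm (Fin n)} (hs : s ∈ simpleReflections n)
    {l : List (Perm (Fin n))} (hl : ∀ t ∈ l, t ∈ simpleReflections n) (w : Perm (Fin n)) :
    demazureLeft (l.foldl demazureSimple w) s = l.foldl demazureSimple (demazureLeft w s) := by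
  induction l generalizing w with
  | nil => rfl
  | cons t l ih =>
    rw [List.foldl_cons, List.foldl_cons, ih (fun r hr ↦ hl r (by simp [hr])),
      demazureLeft_demazureSimple hs (hl t (by simp))]

theorem foldl_demazureLeft_foldl {k l : List (Perm (Fin n))}
    (hk : ∀ t ∈ k, t ∈ simpleReflections n) (hl : ∀ t ∈ l, t ∈ simpleReflections n)
    (w : Perm (Fin n)) :
    k.foldl demazureLeft (l.foldl demazureSimple w) =
      l.foldl demazureSimple (k.foldl demazureLeft w) := by
  induction k generalizing w with
  | nil => rfl
  | cons s k ih =>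
    rw [List.foldl_cons, List.foldl_cons, demazureLeft_foldl (hk s (by simp)) hl,
      ih fun r hr ↦ hk r (by simp [hr])]

theorem foldl_demazureLeft (l : List (Perm (Fin n))) (w : Perm (Fin n)) :
    l.foldl demazureLeft w = (l.foldl demazureSimple w⁻¹)⁻¹ := by
  induction l generalizing w with
  | nil => simp
  | cons s l ih => rw [List.foldl_cons, List.foldl_cons, ih, demazureLeft, inv_inv]

theorem demazureSimple_eq_or (w s : Perm (Fin n)) :
    demazureSimple w s = w * s ∨ demazureSimple w s = w := by
  unfold demazureSimple
  split_ifs <;> simp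

theorem length_mul_le {s : Perm (Fin n)} (hs : s ∈ simpleReflections n) (w : Perm (Fin n)) :
    length (w * s) ≤ length w + 1 := by
  obtain ⟨i, j, h, rfl⟩ := hs
  simpa only [length_eq_invCount] using invCount_mul_swap_le h w

theorem IsReducedWord.foldl_demazureSimple {l : List (Perm (Fin n))} {w : Perm (Fin n)}
    (h : IsReducedWord l w) : l.foldl demazureSimple 1 = w := by
  obtain ⟨⟨hl, rfl⟩, hlen⟩ := h
  induction l using List.reverseRecOn with
  | nil => rfl
  | append_singleton l s ih =>
    have hl' : ∀ t ∈ l, t ∈ simpleReflections n := fun t ht ↦ hl t (by simp [ht])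
    have h1 := length_prod_le hl'
    have h2 := length_mul_le (hl s (by simp)) l.prod
    simp only [List.prod_append, List.prod_singleton, List.length_append,
      List.length_singleton] at hlen
    rw [List.foldl_append, List.foldl_cons, List.foldl_nil, ih hl' (by omega), demazureSimple,
      if_pos (by omega), List.prod_append, List.prod_singleton]

theorem length_foldl_demazureSimple {l : List (Perm (Fin n))}
    (hl : ∀ s ∈ l, s ∈ simpleReflections n) :
    length (l.foldl demazureSimple 1) ≤ l.length ∧
      (length (l.foldl demazureSimple 1) = l.length → l.foldl demazureSimple 1 = l.prod) := by
  induction l using List.reverseRecOn with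
  | nil => simpa using length_prod_le hl
  | append_singleton l s ih =>
    obtain ⟨h1, h2⟩ := ih fun t ht ↦ hl t (by simp [ht])
    have h3 := length_mul_le (hl s (by simp)) (l.foldl demazureSimple 1)
    simp only [List.foldl_append, List.foldl_cons, List.foldl_nil, List.prod_append,
      List.prod_singleton, List.length_append, List.length_singleton]
    rcases demazureSimple_eq_or (l.foldl demazureSimple 1) s with h | h <;> rw [h]
    · exact ⟨by omega, fun h4 ↦ by rw [h2 (by omega)]⟩
    · exact ⟨by omega, fun h4 ↦ by omega⟩

theorem isReducedWord_reducedWord (w : Perm (Fin n)) : IsReducedWord (reducedWord w) w :=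
  Classical.choose_spec (exists_isReducedWord w)

theorem IsReducedWord.foldl_demazureLeft_reverse {l : List (Perm (Fin n))} {u : Perm (Fin n)}
    (h : IsReducedWord l u) : l.reverse.foldl demazureLeft 1 = u := by
  rw [foldl_demazureLeft, inv_one, h.reverse.foldl_demazureSimple, inv_inv]

theorem foldl_demazureSimple_eq {l : List (Perm (Fin n))}
    (hl : ∀ s ∈ l, s ∈ simpleReflections n) (u : Perm (Fin n)) :
    l.foldl demazureSimple u =
      (reducedWord u).reverse.foldl demazureLeft (l.foldl demazureSimple 1) := by
  have hu := isReducedWord_reducedWord u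
  rw [foldl_demazureLeft_foldl hu.reverse.1.1 hl, hu.foldl_demazureLeft_reverse]

/-- `u` arises from `1` by left actions, which commute with right ones, so the effect of a word on
`u` depends only on its effect on `1`. This supplies the associativity and the independence of
reduced words used later. -/
theorem foldl_demazureSimple_eq_demazure {l : List (Perm (Fin n))}
    (hl : ∀ s ∈ l, s ∈ simpleReflections n) (u : Perm (Fin n)) :
    l.foldl demazureSimple u = demazure u (l.foldl demazureSimple 1) := by
  have hv := isReducedWord_reducedWord (l.foldl demazureSimple 1)
  rw [demazure, foldl_demazureSimple_eq hl, foldl_demazureSimple_eq hv.1.1,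
    hv.foldl_demazureSimple]

theorem demazure_inv_left (x w : Perm (Fin n)) :
    demazure w⁻¹ x = (reducedWord w).foldl demazureLeft x := by
  have hx := isReducedWord_reducedWord x
  have hw := isReducedWord_reducedWord w
  rw [demazure, ← hw.reverse.foldl_demazureLeft_reverse, List.reverse_reverse,
    ← foldl_demazureLeft_foldl hw.1.1 hx.1.1, hx.foldl_demazureSimple]

/-! ### Demazure conjugation letter by letter, and the rank -/

/-- Demazure conjugation by a simple generator, `s ∘ x ∘ s`. -/
noncomputable def conjStep (x s : Perm (Fin n)) : Perm (Fin n) :=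
  demazureLeft (demazureSimple x s) s

theorem foldl_conjStep {l : List (Perm (Fin n))} (hl : ∀ s ∈ l, s ∈ simpleReflections n)
    (x : Perm (Fin n)) :
    l.foldl conjStep x = l.foldl demazureSimple (l.foldl demazureLeft x) := by
  induction l generalizing x with
  | nil => rfl
  | cons s l ih =>
    have hl' : ∀ t ∈ l, t ∈ simpleReflections n := fun t ht ↦ hl t (by simp [ht])
    have hs := hl s (by simp)
    rw [List.foldl_cons, ih hl', List.foldl_cons, List.foldl_cons, conjStep,
      demazureLeft_demazureSimple hs hs]
    congr 1
    exact foldl_demazureLeft_foldl (l := [s]) hl' (by simpa using hs) (demazureLeft x s)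

theorem demazureConj_eq_foldl (x w : Perm (Fin n)) :
    demazureConj x w = (reducedWord w).foldl conjStep x := by
  rw [foldl_conjStep (isReducedWord_reducedWord w).1.1, demazureConj, demazure_inv_left, demazure]

theorem foldl_conjStep_eq_demazureConj {l : List (Perm (Fin n))}
    (hl : ∀ s ∈ l, s ∈ simpleReflections n) (x : Perm (Fin n)) :
    l.foldl conjStep x = demazureConj x (l.foldl demazureSimple 1) := by
  rw [foldl_conjStep hl, demazureConj, demazure_inv_left, foldl_demazureSimple_eq_demazure hl,
    foldl_demazureLeft l, foldl_demazureSimple_eq_demazure hl, foldl_demazureLeft, demazure]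
  rfl

theorem invCount_inv (w : Perm (Fin n)) : invCount w⁻¹ = invCount w := by
  rw [← length_eq_invCount, length_inv, length_eq_invCount]

theorem apply_apply_of_inv_eq {y : Perm (Fin n)} (hy : y⁻¹ = y) (a : Fin n) : y (y a) = a := by
  have h : y⁻¹ (y a) = a := y.symm_apply_apply a
  rwa [hy] at h

theorem inv_conj_swap {y : Perm (Fin n)} (hy : y⁻¹ = y) (i j : Fin n) :
    (swap i j * y * swap i j)⁻¹ = swap i j * y * swap i j := by
  simp [hy, mul_assoc]

theorem conjStep_of_gt {i j : Fin n} (h : (i : ℕ) + 1 = j) {z : Perm (Fin n)} (hz : z⁻¹ = z)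
    (hlt : z j < z i) : conjStep z (swap i j) = z := by
  rw [conjStep, demazureSimple_swap h, if_neg hlt.asymm, demazureLeft_swap h, hz,
    if_neg hlt.asymm]

theorem conjStep_of_fixed {i j : Fin n} (h : (i : ℕ) + 1 = j) {z : Perm (Fin n)} (hz : z⁻¹ = z)
    (hi : z i = i) (hj : z j = j) : conjStep z (swap i j) = z * swap i j := by
  have hij : i < j := by rw [Fin.lt_def]; omega
  rw [conjStep, demazureSimple_swap h, hi, hj, if_pos hij, demazureLeft_swap h, mul_inv_rev, hz,
    swap_inv, Perm.mul_apply, Perm.mul_apply, hi, hj, swap_apply_left, swap_apply_right,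
    if_neg hij.asymm]

theorem swap_mul_apply_lt {i j : Fin n} (h : (i : ℕ) + 1 = j) {z : Perm (Fin n)}
    (hlt : z i < z j) (hne : ¬(z i = i ∧ z j = j)) : (swap i j * z) i < (swap i j * z) j :=
  swap_lt_swap h hlt hne

theorem conjStep_of_lt {i j : Fin n} (h : (i : ℕ) + 1 = j) {z : Perm (Fin n)} (hz : z⁻¹ = z)
    (hlt : z i < z j) (hne : ¬(z i = i ∧ z j = j)) :
    conjStep z (swap i j) = swap i j * z * swap i j := by
  rw [conjStep, demazureSimple_swap h, if_pos hlt, demazureLeft_swap h, mul_inv_rev, hz,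
    swap_inv, if_pos (swap_mul_apply_lt h hlt hne), mul_assoc]

/-- A multiple of the rank function of involution weak order: every strict conjugation step
raises it by four. -/
def conjRank (z : Perm (Fin n)) : ℕ :=
  2 * invCount z + z.support.card

/-- If `i` and `j` are fixed, the step adds one inversion and two support points, `2 + 2`. Otherwise
it is an honest conjugation: two new inversions and a support of the same size, `4 + 0`. -/
theorem conjRank_conjStep {i j : Fin n} (h : (i : ℕ) + 1 = j) {z : Perm (Fin n)} (hz : z⁻¹ = z)
    (hlt : z i < z j) : conjRank (conjStep z (swap i j)) = conjRank z + 4 := by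
  have hij : i ≠ j := by rintro rfl; omega
  by_cases hfix : z i = i ∧ z j = j
  · have hd : z.Disjoint (swap i j) := fun a ↦ by
      by_cases ha : a = i
      · exact Or.inl (ha ▸ hfix.1)
      by_cases hb : a = j
      · exact Or.inl (hb ▸ hfix.2)
      exact Or.inr (swap_apply_of_ne_of_ne ha hb)
    rw [conjStep_of_fixed h hz hfix.1 hfix.2, conjRank, conjRank, invCount_mul_swap h hlt,
      hd.card_support_mul, Perm.card_support_swap hij]
    ring
  · have h1 : conjRank (swap i j * z * swap i j) = 2 * invCount (swap i j * z * swap i j) +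
        z.support.card := by
      rw [conjRank]
      congr 1
      simpa using Perm.card_support_conj (σ := swap i j) (τ := z)
    rw [conjStep_of_lt h hz hlt hfix, h1,
      invCount_mul_swap h (swap_mul_apply_lt h hlt hfix), ← invCount_inv (swap i j * z),
      mul_inv_rev, hz, swap_inv, invCount_mul_swap h hlt, conjRank]
    ring

/-- The involutions, or the involutions without fixed points if `p` holds. -/
def AdmissibleInvolution (p : Prop) (y : Perm (Fin n)) : Prop :=
  y⁻¹ = y ∧ (p → ∀ i, y i ≠ i)

theorem AdmissibleInvolution.conj {p : Prop} {y : Perm (Fin n)} (hy : AdmissibleInvolution p y)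
    (i j : Fin n) : AdmissibleInvolution p (swap i j * y * swap i j) := by
  refine ⟨inv_conj_swap hy.1 i j, fun hp a ha ↦ hy.2 hp (swap i j a) ?_⟩
  rw [Perm.mul_apply, Perm.mul_apply, ← Equiv.eq_symm_apply, symm_swap] at ha
  exact ha

theorem AdmissibleInvolution.conjStep {p : Prop} {i j : Fin n} (h : (i : ℕ) + 1 = j)
    {z : Perm (Fin n)} (hz : AdmissibleInvolution p z) :
    AdmissibleInvolution p (conjStep z (swap i j)) := by
  have hij : i ≠ j := by rintro rfl; omega
  rcases lt_or_gt_of_ne (z.injective.ne hij) with hlt | hlt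
  · by_cases hfix : z i = i ∧ z j = j
    · rw [conjStep_of_fixed h hz.1 hfix.1 hfix.2]
      refine ⟨?_, fun hp ↦ absurd hfix.1 (hz.2 hp i)⟩
      rw [mul_inv_rev, hz.1, swap_inv, Equiv.mul_swap_eq_swap_mul, hfix.1, hfix.2]
    · rw [conjStep_of_lt h hz.1 hlt hfix]
      exact hz.conj i j
  · rwa [conjStep_of_gt h hz.1 hlt]

/-- The involution covered by `y` in involution weak order along the descent `(i, j)`. -/
def down (i j : Fin n) (y : Perm (Fin n)) : Perm (Fin n) :=
  if y i = j then y * swap i j else swap i j * y * swap i j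

theorem AdmissibleInvolution.down {p : Prop} {i j : Fin n} {y : Perm (Fin n)}
    (hy : AdmissibleInvolution p y) (hp : y i = j → ¬p) :
    AdmissibleInvolution p (down i j y) := by
  rw [InvolutionAtoms.down]
  split_ifs with hij
  · refine ⟨?_, fun hp' ↦ absurd hp' (hp hij)⟩
    have hji : y j = i := by rw [← hij, apply_apply_of_inv_eq hy.1]
    rw [mul_inv_rev, hy.1, swap_inv, Equiv.mul_swap_eq_swap_mul, hij, hji, swap_comm]
  · exact hy.conj i j

theorem down_lt {i j : Fin n} (h : (i : ℕ) + 1 = j) {y : Perm (Fin n)}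
    (hlt : y j < y i) : down i j y i < down i j y j := by
  rw [down]
  split_ifs with hij
  · simpa using hlt
  · simp only [Perm.mul_apply, swap_apply_left, swap_apply_right]
    exact swap_lt_swap h hlt fun h1 ↦ hij h1.2

theorem conjStep_down {i j : Fin n} (h : (i : ℕ) + 1 = j) {y : Perm (Fin n)} (hy : y⁻¹ = y)
    (hlt : y j < y i) : conjStep (down i j y) (swap i j) = y := by
  have hd := down_lt h hlt
  have hinv : (down i j y)⁻¹ = down i j y :=
    (AdmissibleInvolution.down (p := False) ⟨hy, fun hf ↦ hf.elim⟩ fun _ ↦ id).1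
  by_cases hij : y i = j
  · have hji : y j = i := by rw [← hij, apply_apply_of_inv_eq hy]
    have hdown : down i j y = y * swap i j := if_pos hij
    rw [conjStep_of_fixed h hinv (by simp [hdown, hji]) (by simp [hdown, hij]), hdown, mul_assoc,
      swap_mul_self, mul_one]
  · have hdown : down i j y = swap i j * y * swap i j := if_neg hij
    rw [conjStep_of_lt h hinv hd, hdown]
    · simp [mul_assoc]
    · rintro ⟨h1, h2⟩
      rw [hdown, Perm.mul_apply, Perm.mul_apply, ← Equiv.eq_symm_apply, symm_swap] at h1 h2
      simp only [swap_apply_left, swap_apply_right] at h1 h2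
      rw [h1, h2, Fin.lt_def] at hlt
      omega

theorem conjStep_descent {i j : Fin n} (h : (i : ℕ) + 1 = j) {z : Perm (Fin n)} (hz : z⁻¹ = z)
    (hlt : z i < z j) : conjStep z (swap i j) j < conjStep z (swap i j) i := by
  by_cases hfix : z i = i ∧ z j = j
  · rw [conjStep_of_fixed h hz hfix.1 hfix.2]
    simpa using hlt
  · rw [conjStep_of_lt h hz hlt hfix]
    simp only [Perm.mul_apply, swap_apply_left, swap_apply_right]
    exact swap_lt_swap h hlt hfix

theorem conjStep_apply_eq_iff {i j : Fin n} (h : (i : ℕ) + 1 = j) {z : Perm (Fin n)}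
    (hz : z⁻¹ = z) (hlt : z i < z j) : conjStep z (swap i j) i = j ↔ z i = i ∧ z j = j := by
  by_cases hfix : z i = i ∧ z j = j
  · rw [conjStep_of_fixed h hz hfix.1 hfix.2]
    simp [hfix]
  · rw [conjStep_of_lt h hz hlt hfix]
    refine iff_of_false (fun h1 ↦ ?_) hfix
    rw [Perm.mul_apply, Perm.mul_apply, ← Equiv.eq_symm_apply, symm_swap] at h1
    simp only [swap_apply_left, swap_apply_right] at h1
    have h2 : z i = j := by rw [← h1, apply_apply_of_inv_eq hz]
    rw [h1, h2, Fin.lt_def] at hlt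
    omega

theorem down_conjStep {i j : Fin n} (h : (i : ℕ) + 1 = j) {z : Perm (Fin n)} (hz : z⁻¹ = z)
    (hlt : z i < z j) : down i j (conjStep z (swap i j)) = z := by
  rw [down]
  split_ifs with hij
  · obtain ⟨hi, hj⟩ := (conjStep_apply_eq_iff h hz hlt).1 hij
    rw [conjStep_of_fixed h hz hi hj]
    simp [mul_assoc]
  · rw [conjStep_of_lt h hz hlt (mt (conjStep_apply_eq_iff h hz hlt).2 hij)]
    simp [mul_assoc]

theorem conjRank_down {i j : Fin n} (h : (i : ℕ) + 1 = j) {y : Perm (Fin n)} (hy : y⁻¹ = y)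
    (hlt : y j < y i) : conjRank y = conjRank (down i j y) + 4 := by
  conv_lhs => rw [← conjStep_down h hy hlt]
  exact conjRank_conjStep h
    (AdmissibleInvolution.down (p := False) ⟨hy, fun hf ↦ hf.elim⟩ fun _ ↦ id).1
    (down_lt h hlt)

/-! ### Saturated chains and atoms -/

/-- `ConjChain x y w` says that `w` is the product of the labels of a saturated chain from `x` to
`y` in involution weak order. -/
inductive ConjChain (x : Perm (Fin n)) : Perm (Fin n) → Perm (Fin n) → Prop
  | refl : ConjChain x x 1
  | step {z w : Perm (Fin n)} {i j : Fin n} (h : (i : ℕ) + 1 = j) (hlt : z i < z j)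
      (hz : ConjChain x z w) : ConjChain x (conjStep z (swap i j)) (w * swap i j)

variable {p : Prop} {x y w : Perm (Fin n)}

theorem ConjChain.admissible (hx : AdmissibleInvolution p x) (hc : ConjChain x y w) :
    AdmissibleInvolution p y := by
  induction hc with
  | refl => exact hx
  | step h hlt hz ih => exact ih.conjStep h

theorem ConjChain.exists_word (hx : x⁻¹ = x) (hc : ConjChain x y w) :
    ∃ l : List (Perm (Fin n)), IsWord l w ∧ l.foldl conjStep x = y ∧
      conjRank y = conjRank x + 4 * l.length := by
  induction hc with
  | refl => exact ⟨[], ⟨by simp, rfl⟩, rfl, rfl⟩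
  | @step z w i j h hlt hz ih =>
    obtain ⟨l, ⟨hl, hp⟩, hf, hr⟩ := ih
    have hz' := (hz.admissible (p := False) ⟨hx, fun hf ↦ hf.elim⟩).1
    refine ⟨l ++ [swap i j], ⟨?_, by simp [hp]⟩, by simp [hf], ?_⟩
    · intro s hs
      rcases List.mem_append.1 hs with hs | hs
      · exact hl s hs
      · exact ⟨i, j, h, by simpa using hs⟩
    · rw [conjRank_conjStep h hz' hlt, hr, List.length_append, List.length_singleton]
      ring

theorem conjRank_foldl_conjStep (hx : x⁻¹ = x) {l : List (Perm (Fin n))}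
    (hl : ∀ s ∈ l, s ∈ simpleReflections n) :
    (l.foldl conjStep x)⁻¹ = l.foldl conjStep x ∧
      conjRank (l.foldl conjStep x) ≤ conjRank x + 4 * l.length ∧
      (conjRank (l.foldl conjStep x) = conjRank x + 4 * l.length →
        ConjChain x (l.foldl conjStep x) l.prod) := by
  induction l using List.reverseRecOn with
  | nil => exact ⟨hx, le_rfl, fun _ ↦ .refl⟩
  | append_singleton l s ih =>
    obtain ⟨i, j, h, rfl⟩ := hl s (by simp)
    obtain ⟨h1, h2, h3⟩ := ih fun t ht ↦ hl t (by simp [ht])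
    have hij : i ≠ j := by rintro rfl; omega
    simp only [List.foldl_append, List.foldl_cons, List.foldl_nil, List.prod_append,
      List.prod_singleton, List.length_append, List.length_singleton]
    refine ⟨(AdmissibleInvolution.conjStep (p := False) h ⟨h1, fun hf ↦ hf.elim⟩).1, ?_⟩
    rcases lt_or_gt_of_ne ((l.foldl conjStep x).injective.ne hij) with hlt | hlt
    · rw [conjRank_conjStep h h1 hlt]
      exact ⟨by omega, fun h4 ↦ .step h hlt (h3 (by omega))⟩
    · rw [conjStep_of_gt h h1 hlt]
      exact ⟨by omega, fun h4 ↦ by omega⟩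

/-- The rank gives a lower bound on the length of every Hecke atom, and equality forces each letter
to be a strict step. Chains attain the bound, so once one exists the minimum is known. -/
theorem relAtoms_eq_setOf_conjChain (hx : x⁻¹ = x) (hc : ∃ w, ConjChain x y w) :
    relAtoms x y = {w | ConjChain x y w} := by
  have hle : ∀ v ∈ heckeAtoms x y, conjRank y ≤ conjRank x + 4 * length v ∧
      (conjRank y = conjRank x + 4 * length v → ConjChain x y v) := fun v hv ↦ by
    have hr := isReducedWord_reducedWord v
    have := (conjRank_foldl_conjStep hx hr.1.1).2
    rwa [← demazureConj_eq_foldl, hr.2, hr.1.2, show demazureConj x v = y from hv] at this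
  have hmem : ∀ v, ConjChain x y v → v ∈ heckeAtoms x y ∧
      conjRank y = conjRank x + 4 * length v := fun v hv ↦ by
    obtain ⟨l, ⟨hl, hp⟩, hf, hr⟩ := hv.exists_word hx
    have h1 : l.foldl demazureSimple 1 ∈ heckeAtoms x y := by
      rw [← hf]
      exact (foldl_conjStep_eq_demazureConj hl x).symm
    have h2 := length_foldl_demazureSimple hl
    have h3 := (hle _ h1).1
    -- The Demazure product of the word is itself a Hecke atom, so the rank bound prevents it from
    -- being shorter than the word; hence it is the ordinary product.
    have h4 : length (l.foldl demazureSimple 1) = l.length := by omega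
    have h5 := h2.2 h4
    rw [hp] at h5
    rw [h5] at h1 h4
    exact ⟨h1, by rw [h4, hr]⟩
  obtain ⟨w, hw⟩ := hc
  ext v
  constructor
  · rintro ⟨hv, hmin⟩
    have h1 := hmin w (hmem w hw).1
    have h2 := (hmem w hw).2
    have h3 := hle v hv
    exact h3.2 (by omega)
  · intro hv
    refine ⟨(hmem v hv).1, fun u hu ↦ ?_⟩
    have h1 := (hmem v hv).2
    have h2 := (hle u hu).1
    omega

theorem ConjChain.eq_or_exists_down (hx : AdmissibleInvolution p x) (hc : ConjChain x y w) :
    (y = x ∧ w = 1) ∨ ∃ (i j : Fin n) (v : Perm (Fin n)), (i : ℕ) + 1 = j ∧ y j < y i ∧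
      (y i = j → ¬p) ∧ ConjChain x (down i j y) v ∧ w = v * swap i j := by
  cases hc with
  | refl => exact Or.inl ⟨rfl, rfl⟩
  | @step z v i j h hlt hz =>
    have hz' := hz.admissible hx
    refine Or.inr ⟨i, j, v, h, conjStep_descent h hz'.1 hlt, fun h1 hp ↦ ?_, ?_, rfl⟩
    · exact hz'.2 hp i ((conjStep_apply_eq_iff h hz'.1 hlt).1 h1).1
    · rwa [down_conjStep h hz'.1 hlt]

theorem ConjChain.of_down {i j : Fin n} (h : (i : ℕ) + 1 = j) (hy : y⁻¹ = y)
    (hlt : y j < y i) (hc : ConjChain x (down i j y) w) : ConjChain x y (w * swap i j) := by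
  have := ConjChain.step h (down_lt h hlt) hc
  rwa [conjStep_down h hy hlt] at this

theorem ConjChain.conjRank_le (hx : x⁻¹ = x) (hc : ConjChain x y w) :
    conjRank x ≤ conjRank y := by
  obtain ⟨l, -, -, h⟩ := hc.exists_word hx
  omega

theorem exists_conjChain
    (hbase : ∀ y : Perm (Fin n), AdmissibleInvolution p y → y = x ∨
      ∃ i j : Fin n, (i : ℕ) + 1 = j ∧ y j < y i ∧ (y i = j → ¬p))
    (hy : AdmissibleInvolution p y) : ∃ w, ConjChain x y w := by
  induction hk : conjRank y using Nat.strong_induction_on generalizing y with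
  | _ k ih =>
    rcases hbase y hy with rfl | ⟨i, j, h, hlt, hp⟩
    · exact ⟨1, .refl⟩
    · have h1 := conjRank_down h hy.1 hlt
      obtain ⟨w, hw⟩ := ih _ (by omega) (hy.down hp) rfl
      exact ⟨_, hw.of_down h hy.1 hlt⟩

/-! ### 321-avoidance forces a single atom -/

theorem Avoids321.inv (hw : Avoids321 w) : Avoids321 w⁻¹ := by
  rintro ⟨i, j, k, hij, hjk, h1, h2⟩
  exact hw ⟨w⁻¹ k, w⁻¹ j, w⁻¹ i, h2, h1, by simpa using hjk, by simpa using hij⟩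

theorem Avoids321.mul_swap {i j : Fin n} (h : (i : ℕ) + 1 = j) (hw : Avoids321 w)
    (hlt : w j < w i) : Avoids321 (w * swap i j) := by
  rintro ⟨a, b, c, hab, hbc, h1, h2⟩
  have key : ∀ a b : Fin n, a < b → (w * swap i j) b < (w * swap i j) a →
      swap i j a < swap i j b := fun a b hab h1 ↦ by
    refine swap_lt_swap h hab ?_
    rintro ⟨rfl, rfl⟩
    exact absurd hlt (by simpa using h1.le)
  exact hw ⟨swap i j a, swap i j b, swap i j c, key a b hab h1, key b c hbc h2, h1, h2⟩

theorem Avoids321.down {i j : Fin n} (h : (i : ℕ) + 1 = j) (hy : y⁻¹ = y) (ha : Avoids321 y)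
    (hlt : y j < y i) : Avoids321 (down i j y) := by
  rw [InvolutionAtoms.down]
  split_ifs with hij
  · exact ha.mul_swap h hlt
  · have h1 := (ha.mul_swap h hlt).inv
    rw [mul_inv_rev, hy, swap_inv] at h1
    have h2 := (h1.mul_swap h (swap_lt_swap h hlt fun h3 ↦ hij h3.2)).inv
    rwa [inv_conj_swap hy] at h2

theorem swap_mul_swap_comm {i j k l : Fin n} (hik : i ≠ k) (hil : i ≠ l) (hjk : j ≠ k)
    (hjl : j ≠ l) : swap i j * swap k l = swap k l * swap i j := by
  rw [Equiv.mul_swap_eq_swap_mul, swap_apply_of_ne_of_ne hik.symm hjk.symm,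
    swap_apply_of_ne_of_ne hil.symm hjl.symm]

theorem down_apply_eq_iff {i j k l : Fin n} (hik : i ≠ k) (hil : i ≠ l) (hjk : j ≠ k)
    (hjl : j ≠ l) : down i j y k = l ↔ y k = l := by
  rw [down]
  split_ifs
  · rw [Perm.mul_apply, swap_apply_of_ne_of_ne hik.symm hjk.symm]
  · rw [Perm.mul_apply, Perm.mul_apply, swap_apply_of_ne_of_ne hik.symm hjk.symm,
      ← Equiv.eq_symm_apply, symm_swap, swap_apply_of_ne_of_ne hil.symm hjl.symm]

theorem down_comm {i j k l : Fin n} (hik : i ≠ k) (hil : i ≠ l) (hjk : j ≠ k) (hjl : j ≠ l) :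
    down k l (down i j y) = down i j (down k l y) := by
  have hc := swap_mul_swap_comm hik hil hjk hjl
  have hc' : ∀ u, swap i j * (swap k l * u) = swap k l * (swap i j * u) := fun u ↦ by
    rw [← mul_assoc, hc, mul_assoc]
  have h1 := down_apply_eq_iff (y := y) hik hil hjk hjl
  have h2 := down_apply_eq_iff (y := y) hik.symm hjk.symm hil.symm hjl.symm
  rw [down, down.eq_def i j (down k l y)]
  simp only [h1, h2]
  simp only [down]
  split_ifs <;> simp only [mul_assoc, hc, hc']

/-- Conjugation could destroy the other descent only if `y` exchanged the two pairs, with `y l = i`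
and `y k = j`; that already gives a 321 pattern. -/
theorem down_descent {i j k l : Fin n} (h : (i : ℕ) + 1 = j) (h' : (k : ℕ) + 1 = l)
    (hik : i ≠ k) (hil : i ≠ l) (hjk : j ≠ k) (hjl : j ≠ l) (hy : y⁻¹ = y)
    (ha : Avoids321 y) (hlt : y j < y i) (hlt' : y l < y k) :
    down i j y l < down i j y k := by
  rw [down]
  split_ifs
  · rwa [Perm.mul_apply, Perm.mul_apply, swap_apply_of_ne_of_ne hik.symm hjk.symm,
      swap_apply_of_ne_of_ne hil.symm hjl.symm]
  · simp only [Perm.mul_apply]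
    rw [swap_apply_of_ne_of_ne hik.symm hjk.symm, swap_apply_of_ne_of_ne hil.symm hjl.symm]
    refine swap_lt_swap h hlt' ?_
    rintro ⟨hl, hk⟩
    have hyi : y i = l := by rw [← hl, apply_apply_of_inv_eq hy]
    have hyj : y j = k := by rw [← hk, apply_apply_of_inv_eq hy]
    have hij : i < j := by rw [Fin.lt_def]; omega
    have hkl : k < l := by rw [Fin.lt_def]; omega
    rcases lt_or_gt_of_ne hjk with h1 | h1
    · exact ha ⟨i, j, k, hij, h1, hlt, by rw [hyj, hk]; exact h1⟩
    · have h2 : l < i := by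
        simp only [Fin.lt_def, ne_eq, Fin.ext_iff] at *
        omega
      exact ha ⟨k, l, i, hkl, h2, hlt', by rw [hl, hyi]; exact h2⟩

/-- Compare the last labels of two chains. Distinct descents share no letter, since overlapping ones
form a 321 pattern, so both lower involutions cover a common one. Induction identifies each chain
with one through it, and the last two labels commute. -/
theorem ConjChain.unique (hx : AdmissibleInvolution p x)
    (hreach : ∀ y : Perm (Fin n), AdmissibleInvolution p y → ∃ w, ConjChain x y w)
    (ha : Avoids321 y) {w' : Perm (Fin n)} (hw : ConjChain x y w) (hw' : ConjChain x y w') :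
    w = w' := by
  induction hk : conjRank y using Nat.strong_induction_on generalizing y w w' with
  | _ m ih =>
    have hy := hw.admissible hx
    rcases hw.eq_or_exists_down hx with ⟨rfl, rfl⟩ | ⟨i, j, u, h, hlt, hp, hu, rfl⟩ <;>
      rcases hw'.eq_or_exists_down hx with ⟨h0, rfl⟩ | ⟨k, l, v, h', hlt', hp', hv, rfl⟩
    · rfl
    · have h1 := hv.conjRank_le hx.1
      have h2 := conjRank_down h' hx.1 hlt'
      omega
    · subst h0
      have h1 := hu.conjRank_le hx.1
      have h2 := conjRank_down h hx.1 hlt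
      omega
    · have hr := conjRank_down h hy.1 hlt
      have hr' := conjRank_down h' hy.1 hlt'
      have hij : i < j := by rw [Fin.lt_def]; omega
      have hkl : k < l := by rw [Fin.lt_def]; omega
      by_cases hik : i = k
      · subst hik
        obtain rfl : j = l := Fin.ext (by omega)
        rw [ih _ (by omega) (ha.down h hy.1 hlt) hu hv rfl]
      have hjl : j ≠ l := fun h1 ↦ hik (Fin.ext (by rw [Fin.ext_iff] at h1; omega))
      have hjk : j ≠ k := by
        rintro rfl
        exact ha ⟨i, j, l, hij, hkl, hlt, hlt'⟩
      have hil : i ≠ l := by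
        rintro rfl
        exact ha ⟨k, i, j, hkl, hij, hlt', hlt⟩
      have hz := hy.down hp
      obtain ⟨q, hq⟩ := hreach _ (hz.down (i := k) (j := l) fun h1 ↦
        hp' ((down_apply_eq_iff hik hil hjk hjl).1 h1))
      have hq' := hq
      rw [down_comm hik hil hjk hjl] at hq'
      have e1 := hq.of_down h' hz.1 (down_descent h h' hik hil hjk hjl hy.1 ha hlt hlt')
      have e2 := hq'.of_down h (hy.down hp').1 (down_descent h' h (Ne.symm hik) hjk.symm hil.symm
        hjl.symm hy.1 ha hlt' hlt)
      rw [ih _ (by omega) (ha.down h hy.1 hlt) hu e1 rfl,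
        ih _ (by omega) (ha.down h' hy.1 hlt') hv e2 rfl, mul_assoc, mul_assoc,
        swap_mul_swap_comm hik hil hjk hjl]

/-! ### A 321 pattern yields two atoms -/

/-- An involution is nesting if one of its cycles lies below another cycle. -/
def Nesting (y : Perm (Fin n)) : Prop :=
  ∃ a b : Fin n, a < b ∧ b ≤ y b ∧ y b < y a

/-- If the middle letter satisfies `j ≤ y j`, then `(i, j)` is nested; otherwise apply `y` to the
last two letters of the pattern. -/
theorem nesting_of_not_avoids321 (hy : y⁻¹ = y) (ha : ¬Avoids321 y) : Nesting y := by
  obtain ⟨i, j, k, hij, hjk, h1, h2⟩ := not_not.1 ha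
  rcases le_or_gt j (y j) with h | h
  · exact ⟨i, j, hij, h, h1⟩
  · exact ⟨y k, y j, h2, by rw [apply_apply_of_inv_eq hy]; exact h.le,
      by rwa [apply_apply_of_inv_eq hy, apply_apply_of_inv_eq hy]⟩

theorem conj_swap_apply {i j a b : Fin n} (h : y (swap i j a) = b) :
    (swap i j * y * swap i j) a = swap i j b := by
  rw [Perm.mul_apply, Perm.mul_apply, h]

/-- Shrink the gap between the left endpoints. A letter beside the outer cycle's endpoint, inside
it, either gives a closer nesting or a descent whose conjugation keeps some nesting. Tightness means
both pairs of endpoints are adjacent; `b = c` is an inner fixed point. -/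
theorem Nesting.conj_or_tight (hy : y⁻¹ = y) (hn : Nesting y) :
    (∃ i j : Fin n, (i : ℕ) + 1 = j ∧ y j < y i ∧ y i ≠ j ∧
      Nesting (swap i j * y * swap i j)) ∨
    ∃ a b c d : Fin n, (a : ℕ) + 1 = b ∧ (c : ℕ) + 1 = d ∧ b ≤ c ∧ y a = d ∧ y b = c := by
  obtain ⟨a, b, hab, hb, hlt⟩ := hn
  induction hk : (b : ℕ) - a using Nat.strong_induction_on generalizing a b with
  | _ m ih =>
    have hyy := apply_apply_of_inv_eq hy
    rcases eq_or_lt_of_le (show (a : ℕ) + 1 ≤ b from hab) with he | he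
    · by_cases hd : (y b : ℕ) + 1 = y a
      · exact Or.inr ⟨a, b, y b, y a, he, hd, hb, rfl, rfl⟩
      have hd' : (y b : ℕ) + 1 < y a := lt_of_le_of_ne hlt hd
      obtain ⟨f, hf⟩ : ∃ f : Fin n, (f : ℕ) + 1 = y a := ⟨⟨y a - 1, by omega⟩, by simp; omega⟩
      have hcf : y b < f := by rw [Fin.lt_def]; omega
      have hfd : f < y a := by rw [Fin.lt_def]; omega
      rcases lt_trichotomy (y f) a with hg | hg | hg
      · refine Or.inl ⟨a, b, he, hlt, by order, y f, a, hg, ?_⟩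
        have e1 : (swap a b * y * swap a b) a = swap a b (y b) := conj_swap_apply (by simp)
        have e2 : (swap a b * y * swap a b) (y f) = swap a b f := by
          refine conj_swap_apply ?_
          rw [swap_apply_of_ne_of_ne (by order) (by order), hyy]
        rw [swap_apply_of_ne_of_ne (by order) (by order)] at e2
        rw [e1, e2]
        rcases eq_or_lt_of_le hb with h1 | h1
        · rw [← h1, swap_apply_right]
          exact ⟨le_rfl, by order⟩
        · rw [swap_apply_of_ne_of_ne (by order) (by order)]
          exact ⟨by order, by order⟩
      · exact absurd (hyy f) (by rw [hg]; exact hfd.ne')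
      · refine Or.inl ⟨f, y a, hf, by rwa [hyy], ?_, a, b, hab, ?_⟩
        · intro h1
          have := y.injective h1
          order
        have e1 : (swap f (y a) * y * swap f (y a)) a = swap f (y a) (y a) := by
          refine conj_swap_apply ?_
          rw [swap_apply_of_ne_of_ne (by order) (by order)]
        have e2 : (swap f (y a) * y * swap f (y a)) b = swap f (y a) (y b) := by
          refine conj_swap_apply ?_
          rw [swap_apply_of_ne_of_ne (by order) (by order)]
        rw [swap_apply_right] at e1
        rw [swap_apply_of_ne_of_ne (by order) (by order)] at e2
        rw [e1, e2]
        exact ⟨hb, hcf⟩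
    · obtain ⟨e, hae⟩ : ∃ e : Fin n, (a : ℕ) + 1 = e := ⟨⟨a + 1, by omega⟩, rfl⟩
      have hae' : a < e := by rw [Fin.lt_def]; omega
      have heb : e < b := by rw [Fin.lt_def]; omega
      rcases lt_or_gt_of_ne (y.injective.ne heb.ne) with h1 | h1
      · rcases le_or_gt e (y e) with h2 | h2
        · exact ih _ (by omega) a e hae' h2 (by order) rfl
        · refine Or.inl ⟨a, e, hae, by order, by order, e, b, heb, ?_⟩
          have e1 : (swap a e * y * swap a e) e = swap a e (y a) := conj_swap_apply (by simp)
          have e2 : (swap a e * y * swap a e) b = swap a e (y b) := by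
            refine conj_swap_apply ?_
            rw [swap_apply_of_ne_of_ne (by order) (by order)]
          rw [swap_apply_of_ne_of_ne (by order) (by order)] at e1 e2
          rw [e1, e2]
          exact ⟨hb, hlt⟩
      · exact ih _ (by omega) e b heb hb h1 rfl

theorem ConjChain.exists_ne_of_nesting
    (hreach : ∀ y : Perm (Fin n), AdmissibleInvolution p y → ∃ w, ConjChain x y w)
    (hy : AdmissibleInvolution p y) (hn : Nesting y) :
    ∃ w w', w ≠ w' ∧ ConjChain x y w ∧ ConjChain x y w' := by
  induction hk : conjRank y using Nat.strong_induction_on generalizing y with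
  | _ m ih =>
    rcases hn.conj_or_tight hy.1 with ⟨i, j, h, hlt, hij, hn'⟩ | ⟨a, b, c, d, hab, hcd, hbc, ha, hb⟩
    · have hd : down i j y = swap i j * y * swap i j := if_neg hij
      have hr := conjRank_down h hy.1 hlt
      rw [← hd] at hn'
      obtain ⟨w, w', hne, h1, h2⟩ := ih _ (by omega) (hy.down fun h1 ↦ absurd h1 hij) hn' rfl
      exact ⟨_, _, fun h3 ↦ hne (mul_right_cancel h3), h1.of_down h hy.1 hlt,
        h2.of_down h hy.1 hlt⟩
    have hyy := apply_apply_of_inv_eq hy.1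
    have hd : y d = a := by rw [← ha, hyy]
    -- From here the nesting is tight: `y` interchanges the two adjacent pairs, so multiplying by
    -- one swap on one side is multiplying by the other swap on the other side.
    have hc : y c = b := by rw [← hb, hyy]
    have hab' : a < b := by rw [Fin.lt_def]; omega
    have hcd' : c < d := by rw [Fin.lt_def]; omega
    have d1 : down a b y = swap a b * y * swap a b := if_neg (by rw [ha]; order)
    have d2 : down c d y = swap c d * y * swap c d := if_neg (by rw [hc]; order)
    have e1 : y * swap a b = swap c d * y := by
      rw [Equiv.mul_swap_eq_swap_mul, ha, hb, swap_comm]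
    have e2 : y * swap c d = swap a b * y := by
      rw [Equiv.mul_swap_eq_swap_mul, hc, hd, swap_comm]
    have l1 : y b < y a := by rw [ha, hb]; exact hcd'
    have l2 : y d < y c := by rw [hc, hd]; exact hab'
    have hne : swap a b ≠ swap c d := fun h1 ↦ by
      have h2 := congrArg (fun f : Perm (Fin n) ↦ f a) h1
      rw [swap_apply_left, swap_apply_of_ne_of_ne (by order) (by order)] at h2
      order
    have p1 : AdmissibleInvolution p (down a b y) := hy.down fun h1 ↦ by rw [ha] at h1; order
    have p2 : AdmissibleInvolution p (down c d y) := hy.down fun h1 ↦ by rw [hc] at h1; order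
    rcases eq_or_lt_of_le hbc with rfl | hbc'
    -- With the fixed point `b` between `a` and `d`, the two orders of descending twice reach the
    -- same involution, with label products `s_b s_a` and `s_a s_b`.
    · have hnp : ¬p := fun hp ↦ hy.2 hp b hb
      have q1 : down a b y b = d := by
        rw [d1, conj_swap_apply (b := d) (by simpa using ha),
          swap_apply_of_ne_of_ne (by order) (by order)]
      have q2 : down b d y a = b := by
        rw [d2, conj_swap_apply (b := d) (by
          rwa [swap_apply_of_ne_of_ne (by order) (by order)]), swap_apply_right]
      have q1' : down a b y d = b := by rw [← q1, apply_apply_of_inv_eq p1.1]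
      have q2' : down b d y b = a := by
        have h1 := apply_apply_of_inv_eq p2.1 a
        rwa [q2] at h1
      have r1 : down b d (down a b y) = down a b y * swap b d := if_pos q1
      have r2 : down a b (down b d y) = down b d y * swap a b := if_pos q2
      have s1 : swap a b * swap b d = swap a d * swap a b := by
        rw [Equiv.mul_swap_eq_swap_mul, swap_apply_right,
          swap_apply_of_ne_of_ne (by order) (by order)]
      have s2 : swap b d * swap a b = swap a d * swap b d := by
        rw [Equiv.mul_swap_eq_swap_mul, swap_apply_left,
          swap_apply_of_ne_of_ne (by order) (by order)]
      have heq : down b d (down a b y) = down a b (down b d y) := by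
        calc down b d (down a b y) = swap a b * (y * swap a b) * swap b d := by
              rw [r1, d1]; simp only [mul_assoc]
          _ = (swap a b * swap b d) * (y * swap b d) := by rw [e1]; simp only [mul_assoc]
          _ = swap a d * (swap a b * swap a b) * y := by rw [s1, e2]; simp only [mul_assoc]
          _ = swap a d * (swap b d * swap b d) * y := by rw [swap_mul_self, swap_mul_self]
          _ = (swap b d * swap a b) * (y * swap a b) := by rw [s2, e1]; simp only [mul_assoc]
          _ = swap b d * (y * swap b d) * swap a b := by rw [e2]; simp only [mul_assoc]
          _ = down a b (down b d y) := by rw [r2, d2]; simp only [mul_assoc]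
      obtain ⟨w, hw⟩ := hreach _ (p1.down (i := b) (j := d) fun _ ↦ hnp)
      have hw' := hw
      rw [heq] at hw'
      refine ⟨_, _, ?_, (hw.of_down hcd p1.1 (by rw [q1, q1']; exact hcd')).of_down hab hy.1 l1,
        (hw'.of_down hab p2.1 (by rw [q2, q2']; exact hab')).of_down hcd hy.1 l2⟩
      rw [mul_assoc, mul_assoc, s1, s2]
      exact fun h1 ↦ hne (mul_left_cancel (mul_left_cancel h1)).symm
    -- With two genuine cycles, both descents lead to the same involution in one step, but under
    -- different labels.
    · have hcomm : swap a b * swap c d = swap c d * swap a b :=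
        swap_mul_swap_comm (by order) (by order) (by order) (by order)
      have heq : down a b y = down c d y := by
        rw [d1, d2, mul_assoc, mul_assoc, e1, e2, ← mul_assoc, ← mul_assoc, hcomm]
      obtain ⟨w, hw⟩ := hreach _ p1
      have hw' := hw
      rw [heq] at hw'
      exact ⟨_, _, fun h1 ↦ hne (mul_left_cancel h1), hw.of_down hab hy.1 l1,
        hw'.of_down hcd hy.1 l2⟩

theorem ncard_relAtoms_eq_one_iff (hx : AdmissibleInvolution p x)
    (hbase : ∀ y : Perm (Fin n), AdmissibleInvolution p y → y = x ∨
      ∃ i j : Fin n, (i : ℕ) + 1 = j ∧ y j < y i ∧ (y i = j → ¬p))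
    (hy : AdmissibleInvolution p y) : (relAtoms x y).ncard = 1 ↔ Avoids321 y := by
  have hreach : ∀ y : Perm (Fin n), AdmissibleInvolution p y → ∃ w, ConjChain x y w :=
    fun y hy ↦ exists_conjChain hbase hy
  rw [relAtoms_eq_setOf_conjChain hx.1 (hreach y hy), Set.ncard_eq_one]
  constructor
  · rintro ⟨u, hu⟩
    by_contra ha
    obtain ⟨w, w', hne, h1, h2⟩ := ConjChain.exists_ne_of_nesting hreach hy
      (nesting_of_not_avoids321 hy.1 ha)
    have h3 : w ∈ ({u} : Set (Perm (Fin n))) := hu ▸ h1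
    have h4 : w' ∈ ({u} : Set (Perm (Fin n))) := hu ▸ h2
    exact hne (h3.trans h4.symm)
  · intro ha
    obtain ⟨u, hu⟩ := hreach y hy
    exact ⟨u, Set.eq_singleton_iff_unique_mem.2 ⟨hu, fun v hv ↦ hv.unique hx hreach ha hu⟩⟩

/-! ### The fixed-point-free base -/

theorem prod_map_swap_apply {l : List (Fin n)} (hl : l.Nodup) (m : Fin n) :
    let q := (l.map fun i : Fin n ↦
      swap (⟨2 * (i : ℕ), by omega⟩ : Fin (2 * n)) ⟨2 * (i : ℕ) + 1, by omega⟩).prod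
    q ⟨2 * (m : ℕ), by omega⟩ =
        (if m ∈ l then ⟨2 * (m : ℕ) + 1, by omega⟩ else ⟨2 * (m : ℕ), by omega⟩) ∧
      q ⟨2 * (m : ℕ) + 1, by omega⟩ =
        (if m ∈ l then ⟨2 * (m : ℕ), by omega⟩ else ⟨2 * (m : ℕ) + 1, by omega⟩) := by
  induction l with
  | nil => simp
  | cons k l ih =>
    obtain ⟨hk, hl⟩ := List.nodup_cons.1 hl
    obtain ⟨h1, h2⟩ := ih hl
    simp only [List.map_cons, List.prod_cons, Perm.mul_apply, List.mem_cons, h1, h2]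
    by_cases hm : m = k
    · subst hm
      simp [hk]
    · have hm' : (m : ℕ) ≠ k := fun h ↦ hm (Fin.ext h)
      simp only [hm, false_or]
      split_ifs <;> constructor <;> apply swap_apply_of_ne_of_ne <;>
        simp only [ne_eq, Fin.mk.injEq] <;> omega

theorem fpfBase_apply_even (m : Fin n) :
    fpfBase n ⟨2 * (m : ℕ), by omega⟩ = ⟨2 * (m : ℕ) + 1, by omega⟩ := by
  simpa [fpfBase] using (prod_map_swap_apply (List.nodup_finRange n) m).1

theorem fpfBase_apply_odd (m : Fin n) :
    fpfBase n ⟨2 * (m : ℕ) + 1, by omega⟩ = ⟨2 * (m : ℕ), by omega⟩ := by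
  simpa [fpfBase] using (prod_map_swap_apply (List.nodup_finRange n) m).2

theorem eq_two_mul_or (a : Fin (2 * n)) :
    ∃ m : Fin n, a = ⟨2 * (m : ℕ), by omega⟩ ∨ a = ⟨2 * (m : ℕ) + 1, by omega⟩ := by
  refine ⟨⟨a / 2, by omega⟩, ?_⟩
  simp only [Fin.ext_iff]
  omega

theorem admissibleInvolution_fpfBase : AdmissibleInvolution True (fpfBase n) := by
  constructor
  · rw [inv_eq_iff_mul_eq_one]
    ext a
    obtain ⟨m, rfl | rfl⟩ := eq_two_mul_or a <;>
      simp [fpfBase_apply_even, fpfBase_apply_odd]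
  · intro _ a
    obtain ⟨m, rfl | rfl⟩ := eq_two_mul_or a <;>
      simp [fpfBase_apply_even, fpfBase_apply_odd]

/-- Suppose every descent is a cycle `(i j)` and the letters below `e = 2m` are paired among
themselves. The letter `f` just before `y e` has `y f > e = y (y e)`, a descent; so `y f = y e`,
hence `f = e` and `y e = e + 1`. -/
theorem eq_fpfBase_or_exists_descent {y : Perm (Fin (2 * n))}
    (hy : AdmissibleInvolution True y) : y = fpfBase n ∨
      ∃ i j : Fin (2 * n), (i : ℕ) + 1 = j ∧ y j < y i ∧ (y i = j → ¬True) := by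
  refine or_iff_not_imp_right.2 fun hd ↦ ?_
  have hyy := apply_apply_of_inv_eq hy.1
  have key : ∀ k, ∀ m : Fin n, (m : ℕ) = k →
      y ⟨2 * (m : ℕ), by omega⟩ = ⟨2 * (m : ℕ) + 1, by omega⟩ := by
    intro k
    induction k using Nat.strong_induction_on with
    | _ k ih =>
      rintro m rfl
      have hlow : ∀ a : Fin (2 * n), 2 * (m : ℕ) ≤ a → 2 * (m : ℕ) ≤ y a := fun a ha ↦ by
        by_contra! hlt
        obtain ⟨q, hq⟩ := eq_two_mul_or (y a)
        have hqm : (q : ℕ) < m := by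
          rcases hq with hq | hq <;> rw [hq] at hlt <;> simp at hlt <;> omega
        have h1 := ih q hqm q rfl
        have h2 := hyy a
        rcases hq with hq | hq <;> rw [hq] at h2
        · rw [h1] at h2
          rw [← h2] at ha
          simp at ha
          omega
        · rw [← h1, hyy] at h2
          rw [← h2] at ha
          simp at ha
          omega
      set e : Fin (2 * n) := ⟨2 * (m : ℕ), by omega⟩ with he
      have hev : (e : ℕ) = 2 * m := rfl
      have h1 := hlow e le_rfl
      have h2 : (y e : ℕ) ≠ e := fun h ↦ hy.2 trivial e (Fin.ext h)
      obtain ⟨f, hf⟩ : ∃ f : Fin (2 * n), (f : ℕ) + 1 = y e :=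
        ⟨⟨y e - 1, by omega⟩, by simp; omega⟩
      have h3 := hlow f (by omega)
      have h4 : y f ≠ e := fun h ↦ by
        have := hyy f
        rw [h] at this
        rw [this] at hf
        omega
      have h5 : y (y e) < y f := by
        rw [hyy, Fin.lt_def]
        have : (y f : ℕ) ≠ e := fun h ↦ h4 (Fin.ext h)
        omega
      have h6 : y f = y e := by
        by_contra h
        exact hd ⟨f, y e, hf, h5, fun h' ↦ absurd h' h⟩
      have h7 := y.injective h6
      rw [h7] at hf
      exact Fin.ext (by simp; omega)
  ext a
  obtain ⟨m, rfl | rfl⟩ := eq_two_mul_or a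
  · rw [key m m rfl, fpfBase_apply_even]
  · rw [fpfBase_apply_odd, ← key m m rfl, hyy]

end InvolutionAtoms

theorem mainTheorem12 :
    (∀ (n : ℕ) (x : Equiv.Perm (Fin n)), x⁻¹ = x →
      ((InvolutionAtoms.atoms x).ncard = 1 ↔ InvolutionAtoms.Avoids321 x)) ∧
    (∀ (n : ℕ) (x : Equiv.Perm (Fin (2 * n))), x⁻¹ = x → (∀ i, x i ≠ i) →
      ((InvolutionAtoms.fpfAtoms x).ncard = 1 ↔ InvolutionAtoms.Avoids321 x)) := by
  refine ⟨fun n x hx ↦ ?_, fun n x hx hfix ↦ ?_⟩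
  · refine InvolutionAtoms.ncard_relAtoms_eq_one_iff (p := False) ⟨inv_one, fun h ↦ h.elim⟩
      (fun y _ ↦ ?_) ⟨hx, fun h ↦ h.elim⟩
    exact (InvolutionAtoms.eq_one_or_exists_descent y).imp_right
      fun ⟨i, j, h, hlt⟩ ↦ ⟨i, j, h, hlt, fun _ ↦ id⟩
  · exact InvolutionAtoms.ncard_relAtoms_eq_one_iff InvolutionAtoms.admissibleInvolution_fpfBase
      (fun y hy ↦ InvolutionAtoms.eq_fpfBase_or_exists_descent hy) ⟨hx, fun _ ↦ hfix⟩
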